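/- For a Boolean function $f:\{0,1\}^n\to\{0,1\}$ write $\mathbb{E}f = 2^{-n}\,|\{x : f(x)=1\}|$, and for $S\subseteq[n]=\{1,\dots,n\}$ let $$J_S^+(f) = 2^{-(n-|S|)}\,\bigl|\{u\in\{0,1\}^{[n]\setminus S} : f(u,v)=1 \text{ for some } v\in\{0,1\}^S\}\bigr| ,$$ the probability that a uniformly random setting of the variables outside $S$ does not force $f=0$. Theorem 1.3. For each real $C>0$ there are $\delta>0$ and $n_0\in\mathbb{N}$, both depending only on $C$, such that for every $n\ge n_0$ and every $f:\{0,1\}^n\to\{0,1\}$ with $\mathbb{E}f>n^{-C}$ there is a set $S\subseteq[n]$ with $|S|\le(1/2-\delta)n$ and $J_S^+(f)>0.9$. -/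

import Mathlib

namespace BooleanInfluence

/-- The discrete cube `{0,1}^T` (with `true` as `1` and `false` as `0`). -/
abbrev Cube (T : Type) : Type := T → Bool

/-- The uniform probability measure of a subset `A` of the finite cube `{0,1}^T`. -/
noncomputable def unifMeasure {T : Type} [Fintype T] [DecidableEq T] (A : Set (Cube T)) : ℝ :=
  (A.ncard : ℝ) / (Fintype.card (Cube T) : ℝ)

/-- The expectation `𝔼 f = μ {x : f x = 1}` of a Boolean function. -/
noncomputable def expect {n : ℕ} (f : Cube (Fin n) → Bool) : ℝ :=
  unifMeasure {x : Cube (Fin n) | f x = true}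

/-- The point `(u, v)` of `{0,1}^[n]` whose coordinates off `S` are given by `u` and whose
coordinates in `S` are given by `v`. -/
def glue {n : ℕ} (S : Finset (Fin n)) (u : Cube {i : Fin n // i ∉ S})
    (v : Cube {i : Fin n // i ∈ S}) : Cube (Fin n) :=
  fun i => if h : i ∈ S then v ⟨i, h⟩ else u ⟨i, h⟩

/-- The influence of `S` toward one,
`I_S^+(f) = μ_{[n] \ S} {u : ∃ v ∈ {0,1}^S, f (u, v) = 1} - 𝔼 f`. -/
noncomputable def influencePlus {n : ℕ} (S : Finset (Fin n)) (f : Cube (Fin n) → Bool) : ℝ :=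
  unifMeasure {u : Cube {i : Fin n // i ∉ S} |
    ∃ v : Cube {i : Fin n // i ∈ S}, f (glue S u v) = true} - expect f

/-- `J_S^+(f) = I_S^+(f) + 𝔼 f`: the probability that a uniform setting of the variables
outside `S` does not force `f = 0`. -/
noncomputable def jPlus {n : ℕ} (S : Finset (Fin n)) (f : Cube (Fin n) → Bool) : ℝ :=
  influencePlus S f + expect f

end BooleanInfluence

/-!
Identify a Boolean function with an event in the cube and write `mean p f` for its probability when
every coordinate is `1` independently with probability `p`.

*Reduction to increasing events.* Up-compressing `f` preserves `𝔼 f` and does not increase any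
`J_S^+` (`exists_monotone_shadow_le`), so `f` may be taken monotone; then `J_S^+(f)` is at
least the probability of `f` once the coordinates in `S` are forced to be `1`.

*Low bias.* A uniform point is the join of an independent `s`-biased point `x` and a `t`-biased
point `y`, where `t = 4 ^ (-k)` is a small constant and `s < 1/2 - t/2`. By Chernoff, `x` has at
most `(1/2 - 3t/8) n` ones except with exponentially small probability, so for some such `x`,
forcing its ones leaves an event of `t`-biased probability at least `n ^ (-C) / 2`
(`exists_coalition_low_bias`). Since an increasing event containing `x ⊓ y` contains `x` and `y`, its
`1/4`-biased probability is at least the `k`-th root of this, that is, about `n ^ (-C / k)`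
(`mean_pow_le`); the exponent is as small as desired.

*Sharp threshold.* Raise the bias from `1/4` to `1/2`. As long as no influence exceeds
`n ^ (-1/2)`, the Kahn–Kalai–Linial phenomenon and the Margulis–Russo formula make the probability
grow at logarithmic rate of order `log n`, which over an interval of constant length beats
`n ^ (-C / k)`. A coordinate with larger influence is forced to be `1`, which raises the
probability by at least `n ^ (-1/2) / 2`; this costs `O(√n)` coordinates in all
(`exists_small_coalition`). The total number of forced coordinates is at most `(1/2 - t/4) n`.

The Kahn–Kalai–Linial bound is obtained for all biases at once from a logarithmic Sobolev
inequality with a bias-free constant (`log_sobolev`) by the method of Falik and Samorodnitsky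
(`variance_mul_log_le`).
-/

namespace BooleanInfluence

/-! ### Biased means on the cube -/

/-- The mean of `f` on `{0,1}^n` when the coordinates are independent and each equals `1` with
probability `p`. The recursion splits off the first coordinate, so that statements about product
measures are proved by induction on `n`. No constraint on `p` is built in. -/
noncomputable def mean (p : ℝ) : {n : ℕ} → ((Fin n → Bool) → ℝ) → ℝ
  | 0, f => f Fin.elim0
  | _ + 1, f => p * mean p (fun x => f (Fin.cons true x)) +
      (1 - p) * mean p (fun x => f (Fin.cons false x))

/-- The discrete derivative of `f` in the `i`-th coordinate, as a function on the whole cube that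
does not depend on that coordinate. -/
def deriv₁ {n : ℕ} (i : Fin n) (f : (Fin n → Bool) → ℝ) (x : Fin n → Bool) : ℝ :=
  f (Function.update x i true) - f (Function.update x i false)

section Mean

variable {n : ℕ} {p : ℝ}

theorem mean_succ (f : (Fin (n + 1) → Bool) → ℝ) :
    mean p f = p * mean p (fun x => f (Fin.cons true x)) +
      (1 - p) * mean p (fun x => f (Fin.cons false x)) := rfl

theorem mean_add (f g : (Fin n → Bool) → ℝ) :
    mean p (fun x => f x + g x) = mean p f + mean p g := by
  induction n with
  | zero => rfl
  | succ n ih => simp only [mean_succ, ih]; ring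

theorem mean_const_mul (c : ℝ) (f : (Fin n → Bool) → ℝ) :
    mean p (fun x => c * f x) = c * mean p f := by
  induction n with
  | zero => rfl
  | succ n ih => simp only [mean_succ, ih]; ring

theorem mean_mul_const (c : ℝ) (f : (Fin n → Bool) → ℝ) :
    mean p (fun x => f x * c) = mean p f * c := by
  simp only [mul_comm _ c, mean_const_mul]

theorem mean_const (c : ℝ) : mean p (fun _ : Fin n → Bool => c) = c := by
  induction n with
  | zero => rfl
  | succ n ih => simp only [mean_succ, ih]; ring

theorem mean_sub (f g : (Fin n → Bool) → ℝ) :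
    mean p (fun x => f x - g x) = mean p f - mean p g := by
  have := mean_add (p := p) f (fun x => (-1) * g x)
  rw [mean_const_mul] at this
  simp only [sub_eq_add_neg, neg_one_mul] at this ⊢
  exact this

theorem mean_mono (hp0 : 0 ≤ p) (hp1 : p ≤ 1) {f g : (Fin n → Bool) → ℝ} (h : ∀ x, f x ≤ g x) :
    mean p f ≤ mean p g := by
  induction n with
  | zero => exact h _
  | succ n ih =>
    simp only [mean_succ]
    have := sub_nonneg.2 hp1
    gcongr <;> exact ih fun x => h _

theorem mean_lt (hp0 : 0 < p) (hp1 : p < 1) {f g : (Fin n → Bool) → ℝ} (h : ∀ x, f x ≤ g x)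
    {y : Fin n → Bool} (hy : f y < g y) : mean p f < mean p g := by
  induction n with
  | zero => rwa [Subsingleton.elim y Fin.elim0] at hy
  | succ n ih =>
    have hq : 0 < 1 - p := sub_pos.2 hp1
    have h1 := mean_mono hp0.le hp1.le (f := fun x => f (Fin.cons true x))
      (g := fun x => g (Fin.cons true x)) fun x => h _
    have h2 := mean_mono hp0.le hp1.le (f := fun x => f (Fin.cons false x))
      (g := fun x => g (Fin.cons false x)) fun x => h _
    rw [← Fin.cons_self_tail y] at hy
    simp only [mean_succ]
    cases hb : y 0 <;> rw [hb] at hy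
    · have := ih (f := fun x => f (Fin.cons false x)) (g := fun x => g (Fin.cons false x))
        (fun x => h _) hy
      nlinarith
    · have := ih (f := fun x => f (Fin.cons true x)) (g := fun x => g (Fin.cons true x))
        (fun x => h _) hy
      nlinarith

theorem mean_nonneg (hp0 : 0 ≤ p) (hp1 : p ≤ 1) {f : (Fin n → Bool) → ℝ} (h : ∀ x, 0 ≤ f x) :
    0 ≤ mean p f := by
  simpa only [mean_const] using mean_mono hp0 hp1 (f := fun _ => 0) h

theorem mean_deriv₁ (i : Fin n) (f : (Fin n → Bool) → ℝ) :
    mean p (deriv₁ i f) = mean p (fun x => f (Function.update x i true)) -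
      mean p (fun x => f (Function.update x i false)) :=
  mean_sub _ _

/-- Averaging over one coordinate first does not change the mean. -/
theorem mean_average (i : Fin n) (f : (Fin n → Bool) → ℝ) :
    mean p (fun x => p * f (Function.update x i true) +
      (1 - p) * f (Function.update x i false)) = mean p f := by
  induction n with
  | zero => exact i.elim0
  | succ n ih =>
    refine Fin.cases ?_ (fun i => ?_) i
    · simp only [mean_succ, Fin.update_cons_zero, mean_add, mean_const_mul]; ring
    · simp only [mean_succ, ← Fin.cons_update]
      rw [ih i (fun x => f (Fin.cons true x)), ih i (fun x => f (Fin.cons false x))]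

/-- Forcing coordinate `i` to be `1` raises the mean by `1 - p` times the mean derivative. -/
theorem mean_update_true (i : Fin n) (f : (Fin n → Bool) → ℝ) :
    mean p (fun x => f (Function.update x i true)) =
      mean p f + (1 - p) * mean p (deriv₁ i f) := by
  rw [← mean_average i f, ← mean_const_mul, ← mean_add]
  congr 1; ext x; simp only [deriv₁]; ring

theorem mean_mul_sq_le (hp0 : 0 ≤ p) (hp1 : p ≤ 1) (f g : (Fin n → Bool) → ℝ) :
    mean p (fun x => f x * g x) ^ 2 ≤
      mean p (fun x => f x ^ 2) * mean p (fun x => g x ^ 2) := by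
  have key : ∀ t : ℝ, 0 ≤ mean p (fun x => f x ^ 2) * (t * t) +
      2 * mean p (fun x => f x * g x) * t + mean p (fun x => g x ^ 2) := by
    intro t
    have h := mean_nonneg hp0 hp1 (f := fun x => (t * f x + g x) ^ 2) fun x => sq_nonneg _
    have e : (fun x => (t * f x + g x) ^ 2) =
        fun x => (t * t) * f x ^ 2 + (2 * t) * (f x * g x) + g x ^ 2 := by ext x; ring
    rw [e, mean_add, mean_add, mean_const_mul, mean_const_mul] at h
    linarith
  have := discrim_le_zero key
  simp only [discrim] at this
  nlinarith

/-- Two independent inputs combined coordinatewise by `op` form one biased input; `r` is the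
probability that the combined bit is `1`. -/
theorem mean_mean_comb {r q : ℝ} (op : Bool → Bool → Bool)
    (hr : r = p * (q * (op true true).toNat + (1 - q) * (op true false).toNat) +
      (1 - p) * (q * (op false true).toNat + (1 - q) * (op false false).toNat))
    (f : (Fin n → Bool) → ℝ) :
    mean p (fun x => mean q (fun y => f (fun i => op (x i) (y i)))) = mean r f := by
  induction n with
  | zero => simp only [mean]; congr 1; ext i; exact i.elim0
  | succ n ih =>
    have e : ∀ (a b : Bool) (x y : Fin n → Bool),
        (fun i => op ((Fin.cons a x : Fin (n + 1) → Bool) i) ((Fin.cons b y : Fin (n + 1) → Bool) i))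
          = Fin.cons (op a b) (fun i => op (x i) (y i)) := by
      intro a b x y; ext i; refine Fin.cases ?_ (fun i => ?_) i <;> simp
    simp only [mean_succ, e, mean_add, mean_const_mul]
    have ih' := fun a => ih (fun x => f (Fin.cons a x))
    simp only [ih']
    rw [hr]
    cases op true true <;> cases op true false <;> cases op false true <;>
      cases op false false <;> simp <;> ring

theorem mean_mean_inf (p q : ℝ) (f : (Fin n → Bool) → ℝ) :
    mean p (fun x => mean q (fun y => f (x ⊓ y))) = mean (p * q) f :=
  mean_mean_comb (· ⊓ ·) (by simp) f

theorem mean_mean_sup (p q : ℝ) (f : (Fin n → Bool) → ℝ) :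
    mean p (fun x => mean q (fun y => f (x ⊔ y))) = mean (1 - (1 - p) * (1 - q)) f :=
  mean_mean_comb (· ⊔ ·) (by simp; ring) f

/-- The mean of a monotone function increases with the bias. -/
theorem mean_mono_bias {f : (Fin n → Bool) → ℝ} (hf : Monotone f) {p q : ℝ} (hp : 0 < p)
    (hpq : p ≤ q) (hq : q ≤ 1) : mean p f ≤ mean q f := by
  have hq0 : 0 < q := hp.trans_le hpq
  have e : p = q * (p / q) := by field_simp
  rw [e, ← mean_mean_inf]
  refine mean_mono hq0.le hq fun x => ?_
  calc _ ≤ mean (p / q) (fun _ => f x) :=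
        mean_mono (by positivity) ((div_le_one hq0).2 hpq) fun y => hf inf_le_left
    _ = f x := mean_const _

/-- If `x ⊓ y` satisfies an increasing event, so do `x` and `y`; hence lowering the bias from `q`
to `q ^ k` lowers the probability of the event at least to its `k`-th power. -/
theorem mean_pow_le {f : (Fin n → Bool) → ℝ} (hf : Monotone f) (hf01 : ∀ x, f x = 0 ∨ f x = 1)
    {q : ℝ} (hq0 : 0 ≤ q) (hq1 : q ≤ 1) (k : ℕ) : mean (q ^ k) f ≤ mean q f ^ k := by
  have hf0 : ∀ x, 0 ≤ f x := fun x => by rcases hf01 x with h | h <;> simp [h]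
  have hf1 : ∀ x, f x ≤ 1 := fun x => by rcases hf01 x with h | h <;> simp [h]
  induction k with
  | zero =>
    simpa only [pow_zero, mean_const] using
      mean_mono (p := 1) zero_le_one le_rfl (g := fun _ => 1) hf1
  | succ k ih =>
    rw [pow_succ, ← mean_mean_inf, pow_succ]
    calc _ ≤ mean (q ^ k) (fun x => mean q (fun y => f x * f y)) := by
          refine mean_mono (by positivity) (pow_le_one₀ hq0 hq1) fun x =>
            mean_mono hq0 hq1 fun y => ?_
          have h1 : f (x ⊓ y) ≤ f x := hf inf_le_left
          have h2 : f (x ⊓ y) ≤ f y := hf inf_le_right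
          rcases hf01 x with h | h <;> rw [h] at h1 ⊢ <;> linarith
      _ = mean (q ^ k) f * mean q f := by simp only [mean_const_mul, mean_mul_const]
      _ ≤ _ := by
          gcongr
          exact mean_nonneg hq0 hq1 hf0

/-- The Margulis–Russo formula. -/
theorem hasDerivAt_mean (f : (Fin n → Bool) → ℝ) (p : ℝ) :
    HasDerivAt (fun p => mean p f) (∑ i, mean p (deriv₁ i f)) p := by
  induction n with
  | zero => simpa [mean] using hasDerivAt_const p (f Fin.elim0)
  | succ n ih =>
    have h := ((hasDerivAt_id p).mul (ih (fun x => f (Fin.cons true x)))).add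
      (((hasDerivAt_id p).const_sub 1).mul (ih (fun x => f (Fin.cons false x))))
    refine HasDerivAt.congr_deriv (f := fun p => mean p f) h ?_
    have e0 : mean p (deriv₁ 0 f) = mean p (fun x => f (Fin.cons true x)) -
        mean p (fun x => f (Fin.cons false x)) := by
      rw [mean_deriv₁]; simp only [mean_succ, Fin.update_cons_zero]; ring
    have es : ∀ i : Fin n, mean p (deriv₁ i.succ f) =
        p * mean p (deriv₁ i fun x => f (Fin.cons true x)) +
          (1 - p) * mean p (deriv₁ i fun x => f (Fin.cons false x)) := by
      intro i
      simp only [mean_deriv₁]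
      simp only [mean_succ, ← Fin.cons_update]
      ring
    simp only [Fin.sum_univ_succ, e0, es, Finset.sum_add_distrib, ← Finset.mul_sum, id]
    ring

/-- The moment generating function of the number of ones. -/
theorem mean_exp_card (p l : ℝ) :
    mean p (fun x : Fin n → Bool => Real.exp (l * ∑ i, ((x i).toNat : ℝ))) =
      (1 - p + p * Real.exp l) ^ n := by
  induction n with
  | zero => simp [mean]
  | succ n ih =>
    simp only [mean_succ, Fin.sum_univ_succ, Fin.cons_zero, Fin.cons_succ, mul_add, Real.exp_add,
      mean_const_mul, ih]
    simp; ring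

theorem mean_half_eq_sum (f : (Fin n → Bool) → ℝ) : mean (1 / 2) f = (∑ x, f x) / 2 ^ n := by
  induction n with
  | zero => simpa [mean] using congrArg f (Subsingleton.elim _ _)
  | succ n ih =>
    rw [mean_succ, ih, ih, ← (Fin.consEquiv fun _ => Bool).sum_comp, Fintype.sum_prod_type]
    simp [Fin.consEquiv]
    ring

end Mean

/-! ### The logarithmic Sobolev inequality and influences -/

section LogSobolev

variable {n : ℕ} {p : ℝ}

/-- The logarithmic Sobolev inequality on a two-point space. The constant does not depend on the
bias. -/
theorem two_point_log_sobolev (hp0 : 0 < p) (hp1 : p < 1) {a b : ℝ} (ha : 0 ≤ a) (hb : 0 ≤ b) :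
    p * (a ^ 2 * Real.log (a ^ 2)) + (1 - p) * (b ^ 2 * Real.log (b ^ 2)) -
      (p * a ^ 2 + (1 - p) * b ^ 2) * Real.log (p * a ^ 2 + (1 - p) * b ^ 2) ≤ (a - b) ^ 2 := by
  have hq : 0 < 1 - p := sub_pos.2 hp1
  obtain ⟨m, hm⟩ : ∃ m, m = p * a ^ 2 + (1 - p) * b ^ 2 := ⟨_, rfl⟩
  rw [← hm]
  have hm0 : 0 ≤ m := by rw [hm]; positivity
  rcases hm0.eq_or_lt with h0 | hmpos
  · have ha2 : a = 0 := by
      by_contra h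
      have : 0 < a ^ 2 := by positivity
      nlinarith [mul_pos hp0 this, mul_nonneg hq.le (sq_nonneg b)]
    have hb2 : b = 0 := by
      by_contra h
      have : 0 < b ^ 2 := by positivity
      nlinarith [mul_pos hq this, mul_nonneg hp0.le (sq_nonneg a)]
    simp [ha2, hb2, ← h0]
  · have key : ∀ c : ℝ, c ^ 2 * Real.log (c ^ 2) ≤
        c ^ 2 * Real.log m + c ^ 2 * (c ^ 2 / m - 1) := by
      intro c
      rcases eq_or_ne c 0 with rfl | hc
      · simp
      have hc2 : 0 < c ^ 2 := by positivity
      have := Real.log_le_sub_one_of_pos (div_pos hc2 hmpos)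
      rw [Real.log_div hc2.ne' hmpos.ne'] at this
      nlinarith
    have h1 : p * (a ^ 2 * (a ^ 2 / m - 1)) + (1 - p) * (b ^ 2 * (b ^ 2 / m - 1)) ≤ (a - b) ^ 2 := by
      have e : p * (a ^ 2 * (a ^ 2 / m - 1)) + (1 - p) * (b ^ 2 * (b ^ 2 / m - 1)) =
          p * (1 - p) * (a ^ 2 - b ^ 2) ^ 2 / m := by
        field_simp
        rw [hm]; ring
      rw [e, div_le_iff₀ hmpos, hm]
      have : (a - b) ^ 2 * (p * a ^ 2 + (1 - p) * b ^ 2) - p * (1 - p) * (a ^ 2 - b ^ 2) ^ 2 =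
          (a - b) ^ 2 * (p * a - (1 - p) * b) ^ 2 := by ring
      nlinarith [mul_nonneg (sq_nonneg (a - b)) (sq_nonneg (p * a - (1 - p) * b))]
    have ka := mul_le_mul_of_nonneg_left (key a) hp0.le
    have kb := mul_le_mul_of_nonneg_left (key b) hq.le
    have : m * Real.log m = p * (a ^ 2 * Real.log m) + (1 - p) * (b ^ 2 * Real.log m) := by
      conv_lhs => rw [hm, ← hm]
      nth_rewrite 1 [hm]; ring
    nlinarith

/-- The logarithmic Sobolev inequality on the biased cube. -/
theorem log_sobolev (hp0 : 0 < p) (hp1 : p < 1) (f : (Fin n → Bool) → ℝ) :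
    mean p (fun x => f x ^ 2 * Real.log (f x ^ 2)) -
      mean p (fun x => f x ^ 2) * Real.log (mean p (fun x => f x ^ 2)) ≤
        ∑ i, mean p (fun x => deriv₁ i f x ^ 2) := by
  induction n with
  | zero => simp [mean]
  | succ n ih =>
    have hq : 0 < 1 - p := sub_pos.2 hp1
    set u : (Fin n → Bool) → ℝ := fun x => f (Fin.cons true x) with hu
    set v : (Fin n → Bool) → ℝ := fun x => f (Fin.cons false x) with hv
    have e0 : mean p (fun x => deriv₁ 0 f x ^ 2) = mean p (fun x => (u x - v x) ^ 2) := by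
      simp only [mean_succ, deriv₁, Fin.update_cons_zero, hu, hv]; ring
    have es : ∀ i : Fin n, mean p (fun x => deriv₁ i.succ f x ^ 2) =
        p * mean p (fun x => deriv₁ i u x ^ 2) + (1 - p) * mean p (fun x => deriv₁ i v x ^ 2) := by
      intro i
      simp only [mean_succ, deriv₁, ← Fin.cons_update, hu, hv]
    rw [Fin.sum_univ_succ, e0]
    simp only [es, Finset.sum_add_distrib, ← Finset.mul_sum]
    simp only [mean_succ]
    have iu := mul_le_mul_of_nonneg_left (ih u) hp0.le
    have iv := mul_le_mul_of_nonneg_left (ih v) hq.le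
    have hU : 0 ≤ mean p (fun x => u x ^ 2) := mean_nonneg hp0.le hp1.le fun x => sq_nonneg _
    have hV : 0 ≤ mean p (fun x => v x ^ 2) := mean_nonneg hp0.le hp1.le fun x => sq_nonneg _
    have two := two_point_log_sobolev hp0 hp1 (Real.sqrt_nonneg (mean p (fun x => u x ^ 2)))
      (Real.sqrt_nonneg (mean p (fun x => v x ^ 2)))
    have mink : (√(mean p (fun x => u x ^ 2)) - √(mean p (fun x => v x ^ 2))) ^ 2 ≤
        mean p (fun x => (u x - v x) ^ 2) := by
      have cs := mean_mul_sq_le hp0.le hp1.le u v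
      have cs' : mean p (fun x => u x * v x) ≤
          √(mean p (fun x => u x ^ 2)) * √(mean p (fun x => v x ^ 2)) := by
        rw [← Real.sqrt_mul hU]
        exact Real.le_sqrt_of_sq_le cs
      have e : (fun x => (u x - v x) ^ 2) =
          fun x => u x ^ 2 + v x ^ 2 - 2 * (u x * v x) := by ext x; ring
      rw [e, mean_sub, mean_add, mean_const_mul, sub_sq, Real.sq_sqrt hU, Real.sq_sqrt hV]
      linarith
    rw [Real.sq_sqrt hU, Real.sq_sqrt hV] at two
    simp only [hu, hv] at *
    linarith

/-- A function whose `L¹` norm is small compared with its `L²` norm has large entropy. -/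
theorem entropy_lower_bound (hp0 : 0 ≤ p) (hp1 : p ≤ 1) {ε : ℝ} (hε : 0 < ε)
    (g : (Fin n → Bool) → ℝ) :
    mean p (fun x => g x ^ 2) * (Real.log (1 / ε) + 1) - mean p (fun x => |g x|) ^ 2 / ε ≤
      mean p (fun x => g x ^ 2 * Real.log (g x ^ 2)) -
        mean p (fun x => g x ^ 2) * Real.log (mean p (fun x => g x ^ 2)) := by
  set v := mean p (fun x => g x ^ 2) with hv
  set M := mean p (fun x => |g x|) with hM
  have hv0 : 0 ≤ v := mean_nonneg hp0 hp1 fun x => sq_nonneg _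
  -- The tangent-line bound `log y ≥ 1 - 1 / y` at `y = |g| / z`; the choice `z = √(v / ε)`
  -- turns the error terms into a square.
  have tangent : ∀ z > 0, v * (2 * Real.log z) + 2 * v - 2 * z * M ≤
      mean p (fun x => g x ^ 2 * Real.log (g x ^ 2)) := by
    intro z hz
    rw [hv, hM, ← mean_mul_const, ← mean_const_mul, ← mean_const_mul, ← mean_add, ← mean_sub]
    refine mean_mono hp0 hp1 fun x => ?_
    rcases eq_or_ne (g x) 0 with h | h
    · simp [h]
    have ha : 0 < |g x| := abs_pos.2 h
    have h1 := Real.log_le_sub_one_of_pos (div_pos hz ha)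
    rw [Real.log_div hz.ne' ha.ne', Real.log_abs] at h1
    rw [Real.log_pow]
    have h2 : g x ^ 2 * (z / |g x|) = z * |g x| := by
      rw [← sq_abs]; field_simp
    have h3 := mul_le_mul_of_nonneg_left h1 (sq_nonneg (g x))
    push_cast
    nlinarith
  rcases hv0.eq_or_lt with h0 | hvpos
  · have e : mean p (fun x => g x ^ 2 * Real.log (g x ^ 2)) ≥ -(M ^ 2 / ε) := by
      by_contra! hlt
      have hMn : 0 ≤ M := mean_nonneg hp0 hp1 fun x => abs_nonneg _
      rcases hMn.eq_or_lt with hM0 | hMpos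
      · have := tangent 1 one_pos
        rw [← h0, ← hM0] at this
        rw [← hM0] at hlt
        norm_num at this hlt
        linarith
      · have := tangent (M / (2 * ε)) (by positivity)
        rw [← h0] at this
        have e2 : 2 * (M / (2 * ε)) * M = M ^ 2 / ε := by field_simp
        linarith
    rw [← h0]
    linarith
  · have hz : 0 < √(v / ε) := Real.sqrt_pos.2 (by positivity)
    have h := tangent _ hz
    have hl : 2 * Real.log √(v / ε) = Real.log v + Real.log (1 / ε) := by
      rw [Real.log_sqrt (by positivity), Real.log_div hvpos.ne' hε.ne',
        Real.log_div one_ne_zero hε.ne', Real.log_one]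
      ring
    have hs : √(v / ε) = √v / √ε := Real.sqrt_div hv0 ε
    have hsq : 0 ≤ (√v - M / √ε) ^ 2 := sq_nonneg _
    have hx : (√v - M / √ε) ^ 2 = v - 2 * √(v / ε) * M + M ^ 2 / ε := by
      rw [hs, sub_sq, Real.sq_sqrt hv0, div_pow, Real.sq_sqrt hε.le]; ring
    rw [hl] at h
    nlinarith

/-- The inequality of Falik and Samorodnitsky, a form of the Kahn–Kalai–Linial theorem. The first
coordinate contributes the martingale difference `d`; the log-Sobolev inequality and the entropy
bound are applied to `d`, and induction to the conditional mean. The Dirichlet forms of the two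
parts add up to that of `f`. -/
theorem variance_mul_log_le (hp0 : 0 < p) (hp1 : p < 1) {ε : ℝ} (hε : 0 < ε)
    (f : (Fin n → Bool) → ℝ) :
    (mean p (fun x => f x ^ 2) - mean p f ^ 2) * (Real.log (1 / ε) + 1) ≤
      ∑ i, mean p (fun x => deriv₁ i f x ^ 2) +
        (∑ i, mean p (fun x => |deriv₁ i f x|) ^ 2) / ε := by
  induction n with
  | zero => simp [mean]
  | succ n ih =>
    have hq : 0 < 1 - p := sub_pos.2 hp1
    set u : (Fin n → Bool) → ℝ := fun x => f (Fin.cons true x) with hu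
    set v : (Fin n → Bool) → ℝ := fun x => f (Fin.cons false x) with hv
    set a : (Fin n → Bool) → ℝ := fun x => p * u x + (1 - p) * v x with ha
    set d : (Fin (n + 1) → Bool) → ℝ := fun x => f x - a (Fin.tail x) with hd
    have dt : ∀ x, d (Fin.cons true x) = (1 - p) * (u x - v x) := by
      intro x; simp only [hd, ha, Fin.tail_cons, hu]; ring
    have df : ∀ x, d (Fin.cons false x) = -p * (u x - v x) := by
      intro x; simp only [hd, ha, Fin.tail_cons, hv]; ring
    have main := (entropy_lower_bound hp0.le hp1.le hε d).trans (log_sobolev hp0 hp1 d)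
    have iha := ih a
    -- The variance is the sum of the two variances.
    have var : mean p (fun x => f x ^ 2) - mean p f ^ 2 =
        (mean p (fun x => a x ^ 2) - mean p a ^ 2) + mean p (fun x => d x ^ 2) := by
      have e1 : mean p f = mean p a := by
        rw [mean_succ, ha, mean_add, mean_const_mul, mean_const_mul]
      rw [e1, mean_succ, mean_succ]
      simp only [dt, df]
      have : p * mean p (fun x => u x ^ 2) + (1 - p) * mean p (fun x => v x ^ 2) =
          mean p (fun x => a x ^ 2) + (p * mean p (fun x => ((1 - p) * (u x - v x)) ^ 2) +
            (1 - p) * mean p (fun x => (-p * (u x - v x)) ^ 2)) := by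
        simp only [← mean_const_mul, ← mean_add]
        congr 1; ext x; simp only [ha]; ring
      simp only [hu, hv] at this ⊢
      linarith
    -- The first coordinate.
    have l1 : mean p (fun x => |d x|) ≤ mean p (fun x => |deriv₁ 0 f x|) := by
      simp only [mean_succ, dt, df, deriv₁, Fin.update_cons_zero, abs_mul, abs_neg,
        abs_of_pos hp0, abs_of_pos hq, mean_const_mul]
      have : 0 ≤ mean p (fun x => |u x - v x|) := mean_nonneg hp0.le hp1.le fun x => abs_nonneg _
      simp only [hu, hv] at this ⊢
      nlinarith [mul_nonneg (sq_nonneg (2 * p - 1)) this]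
    have dir0 : mean p (fun x => deriv₁ 0 d x ^ 2) = mean p (fun x => deriv₁ 0 f x ^ 2) := by
      simp only [mean_succ, deriv₁, Fin.update_cons_zero, dt, df]
      simp only [hu, hv]
      ring_nf
    -- The other coordinates.
    have dirs : ∀ i : Fin n, mean p (fun x => deriv₁ i a x ^ 2) +
        mean p (fun x => deriv₁ i.succ d x ^ 2) = mean p (fun x => deriv₁ i.succ f x ^ 2) := by
      intro i
      simp only [mean_succ, deriv₁, ← Fin.cons_update, dt, df]
      simp only [← mean_const_mul, ← mean_add]
      congr 1; ext x; simp only [ha, hu, hv]; ring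
    have l1s : ∀ i : Fin n, mean p (fun x => |deriv₁ i a x|) ≤
        mean p (fun x => |deriv₁ i.succ f x|) := by
      intro i
      simp only [mean_succ, deriv₁, ← Fin.cons_update]
      simp only [← mean_const_mul, ← mean_add]
      refine mean_mono hp0.le hp1.le fun x => ?_
      have := abs_add_le (p * (u (Function.update x i true) - u (Function.update x i false)))
        ((1 - p) * (v (Function.update x i true) - v (Function.update x i false)))
      rw [abs_mul, abs_mul, abs_of_pos hp0, abs_of_pos hq] at this
      refine le_trans (le_of_eq ?_) this
      simp only [ha]; congr 1; ring
    rw [var, add_mul]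
    have s1 : ∑ i, mean p (fun x => deriv₁ i f x ^ 2) =
        ∑ i, mean p (fun x => deriv₁ i a x ^ 2) + ∑ i, mean p (fun x => deriv₁ i d x ^ 2) := by
      rw [Fin.sum_univ_succ, Fin.sum_univ_succ (f := fun i => mean p (fun x => deriv₁ i d x ^ 2)),
        dir0]
      simp only [← dirs, Finset.sum_add_distrib]
      ring
    have s2 : (∑ i, mean p (fun x => |deriv₁ i a x|) ^ 2) / ε + mean p (fun x => |d x|) ^ 2 / ε ≤
        (∑ i, mean p (fun x => |deriv₁ i f x|) ^ 2) / ε := by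
      rw [← add_div, Fin.sum_univ_succ, add_comm]
      gcongr with i
      · exact mean_nonneg hp0.le hp1.le fun x => abs_nonneg _
      · exact mean_nonneg hp0.le hp1.le fun x => abs_nonneg _
      · exact l1s i
    rw [s1]
    linarith

/-- An increasing event all of whose influences are at most `τ` has total influence at least of
order `log (1 / τ)` times its variance. -/
theorem total_influence_lower_bound (hp0 : 0 < p) (hp1 : p < 1) {f : (Fin n → Bool) → ℝ}
    (hf : Monotone f) (hf01 : ∀ x, f x = 0 ∨ f x = 1) {τ : ℝ} (hτ : 0 < τ)
    (h : ∀ i, mean p (deriv₁ i f) ≤ τ) :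
    mean p f * (1 - mean p f) * (Real.log (1 / τ) + 1) ≤ 2 * ∑ i, mean p (deriv₁ i f) := by
  have hd : ∀ i x, deriv₁ i f x = 0 ∨ deriv₁ i f x = 1 := by
    intro i x
    have hm : f (Function.update x i false) ≤ f (Function.update x i true) :=
      hf (Function.update_mono (Bool.false_le _))
    unfold deriv₁
    rcases hf01 (Function.update x i true) with h1 | h1 <;>
      rcases hf01 (Function.update x i false) with h2 | h2 <;> rw [h1, h2] at hm ⊢ <;>
      first | (exfalso; linarith) | norm_num
  have hd0 : ∀ i, 0 ≤ mean p (deriv₁ i f) := fun i =>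
    mean_nonneg hp0.le hp1.le fun x => by rcases hd i x with h | h <;> simp [h]
  have key := variance_mul_log_le hp0 hp1 hτ f
  have e1 : ∀ i, (fun x => deriv₁ i f x ^ 2) = deriv₁ i f := by
    intro i; ext x; rcases hd i x with h | h <;> simp [h]
  have e2 : ∀ i, (fun x => |deriv₁ i f x|) = deriv₁ i f := by
    intro i; ext x; rcases hd i x with h | h <;> simp [h]
  have e3 : (fun x => f x ^ 2) = f := by
    ext x; rcases hf01 x with h | h <;> simp [h]
  simp only [e1, e2, e3] at key
  have s : (∑ i, mean p (deriv₁ i f) ^ 2) / τ ≤ ∑ i, mean p (deriv₁ i f) := by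
    rw [div_le_iff₀ hτ, Finset.sum_mul]
    refine Finset.sum_le_sum fun i _ => ?_
    rw [sq]
    exact mul_le_mul_of_nonneg_left (h i) (hd0 i)
  have e4 : mean p f * (1 - mean p f) = mean p f - mean p f ^ 2 := by ring
  rw [e4]
  linarith

end LogSobolev

/-! ### Raising the bias from one quarter to one half -/

section Coalition

variable {n : ℕ} {p : ℝ}

/-- The indicator vector of a set of coordinates. -/
def ind (S : Finset (Fin n)) : Fin n → Bool := fun i => decide (i ∈ S)

theorem sup_ind_insert (S : Finset (Fin n)) (i : Fin n) (x : Fin n → Bool) :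
    x ⊔ ind (insert i S) = Function.update x i true ⊔ ind S := by
  ext j
  by_cases h : j = i
  · subst h; simp [ind]
  · simp [ind, h]

theorem monotone_sup_ind {f : (Fin n → Bool) → ℝ} (hf : Monotone f) (S : Finset (Fin n)) :
    Monotone (fun x => f (x ⊔ ind S)) :=
  fun _ _ h => hf (sup_le_sup_right h _)

/-- Sweep the bias from `1/4` to `1/2`. While all influences are at most `n ^ (-1/2)`, the
Kahn–Kalai–Linial bound multiplies the measure of the event by a power of `n`; whenever some
influence is larger, forcing that coordinate to be `1` raises the measure by `n ^ (-1/2) / 2`, so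
this happens at most `2 * n ^ (1/2)` times. -/
theorem exists_small_coalition {f : (Fin n → Bool) → ℝ} (hf : Monotone f)
    (hf01 : ∀ x, f x = 0 ∨ f x = 1) (hn : 1 < n)
    (hb : 1 ≤ mean (1 / 4) f * Real.exp (Real.log n / 320)) :
    ∃ S : Finset (Fin n), (S.card : ℝ) ≤ 2 * √n ∧
      0.9 < mean (1 / 2) (fun x => f (x ⊔ ind S)) := by
  have hn0 : (0 : ℝ) < n := by exact_mod_cast (zero_lt_one.trans hn)
  have hlog : 0 < Real.log n := Real.log_pos (by exact_mod_cast hn)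
  have hs : 0 < √(n : ℝ) := Real.sqrt_pos.2 hn0
  set G : Finset (Fin n) → ℝ → ℝ := fun S p => mean p (fun x => f (x ⊔ ind S)) with hG
  set h : ℝ → ℝ := fun p => mean (1 / 4) f * Real.exp (Real.log n / 80 * (p - 1 / 4)) with hh
  have hβ : 0 < mean (1 / 4) f := by
    by_contra! hle
    nlinarith [Real.exp_pos (Real.log n / 320)]
  have hf1 : ∀ x, f x ≤ 1 := fun x => by rcases hf01 x with h | h <;> simp [h]
  have hG1 : ∀ S, ∀ p ∈ Set.Icc (1 / 4 : ℝ) (1 / 2), G S p ≤ 1 := by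
    intro S p hp
    simpa only [mean_const] using mean_mono (p := p) (by linarith [hp.1]) (by linarith [hp.2])
      (g := fun _ => (1 : ℝ)) fun x => hf1 (x ⊔ ind S)
  have hGd : ∀ S p, HasDerivAt (G S) (∑ i, mean p (deriv₁ i (fun x => f (x ⊔ ind S)))) p :=
    fun S p => hasDerivAt_mean _ p
  have hGc : ∀ S, Continuous (G S) := fun S =>
    continuous_iff_continuousAt.2 fun p => (hGd S p).continuousAt
  have hhd : ∀ p, HasDerivAt h (h p * (Real.log n / 80)) p := by
    intro p
    have := ((((hasDerivAt_id p).sub_const (1 / 4)).const_mul (Real.log n / 80)).exp).const_mul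
      (mean (1 / 4) f)
    refine this.congr_deriv ?_
    simp only [hh, id]; ring
  have hhc : Continuous h := continuous_iff_continuousAt.2 fun p => (hhd p).continuousAt
  have hGmono : ∀ S (p q : ℝ), 1 / 4 ≤ p → p ≤ q → q ≤ 1 / 2 → G S p ≤ G S q := by
    intro S p q h1 h2 h3
    exact mean_mono_bias (monotone_sup_ind hf S) (by linarith) h2 (by linarith)
  -- The admissible biases for `S`: those at which `S` has raised the measure as promised.
  set K : Finset (Fin n) → Set ℝ := fun S =>
    {p | p ∈ Set.Icc (1 / 4 : ℝ) (1 / 2) ∧ h p ≤ G S p ∧ S.card / (2 * √n) ≤ G S p} with hK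
  have hKc : ∀ S, IsCompact (K S) := by
    intro S
    refine isCompact_Icc.inter_right (IsClosed.inter ?_ ?_)
    · exact isClosed_le hhc (hGc S)
    · exact isClosed_le continuous_const (hGc S)
  have hK0 : (K ∅).Nonempty := by
    refine ⟨1 / 4, by norm_num, ?_, ?_⟩
    · have e : ∀ x : Fin n → Bool, x ⊔ ind ∅ = x := by intro x; ext j; simp [ind]
      simp [hh, hG, e]
    · simp only [Finset.card_empty, Nat.cast_zero, zero_div]
      exact mean_nonneg (by norm_num) (by norm_num) fun x => by
        rcases hf01 (x ⊔ ind ∅) with h | h <;> simp [h]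
  classical
  obtain ⟨S, hS, hmax⟩ := Finset.exists_max_image
    (Finset.univ.filter fun S : Finset (Fin n) => (K S).Nonempty) Finset.card ⟨∅, by simp [hK0]⟩
  simp only [Finset.mem_filter, Finset.mem_univ, true_and] at hS hmax
  obtain ⟨p, hp, hpmax⟩ := (hKc S).exists_isGreatest hS
  obtain ⟨hpI, hp1, hp2⟩ := hp
  refine ⟨S, ?_, ?_⟩
  · have := hp2.trans (hG1 S p hpI)
    rwa [div_le_one (by positivity)] at this
  by_contra! hcon
  have hend : 1 ≤ h (1 / 2) := by
    simp only [hh]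
    refine hb.trans_eq ?_
    congr 2; ring
  have hp9 : G S p ≤ 0.9 := (hGmono S p _ hpI.1 hpI.2 le_rfl).trans hcon
  have hplt : p < 1 / 2 := by
    refine lt_of_le_of_ne hpI.2 fun he => ?_
    rw [he] at hp1 hp9
    norm_num at hp9
    linarith
  have hp0 : 0 < p := by linarith [hpI.1]
  have hhpos : 0 < h p := mul_pos hβ (Real.exp_pos _)
  by_cases hinf : ∀ i, mean p (deriv₁ i (fun x => f (x ⊔ ind S))) ≤ 1 / √n
  · -- All influences are small, so the measure grows faster than `h` just after `p`.
    have hI := total_influence_lower_bound hp0 (by linarith) (monotone_sup_ind hf S)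
      (fun x => hf01 _) (by positivity) hinf
    rw [one_div_one_div, Real.log_sqrt hn0.le] at hI
    change G S p * (1 - G S p) * _ ≤ _ at hI
    set I := ∑ i, mean p (deriv₁ i (fun x => f (x ⊔ ind S)))
    have hGp : 0 < G S p := hhpos.trans_le hp1
    have hIlt : h p * (Real.log n / 80) < I := by
      have h1 : G S p * (1 / 10) ≤ G S p * (1 - G S p) := by
        apply mul_le_mul_of_nonneg_left _ hGp.le
        norm_num at hp9; linarith
      have h2 := mul_le_mul_of_nonneg_right h1 (by positivity : 0 ≤ Real.log n / 2 + 1)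
      have h3 := mul_le_mul_of_nonneg_right hp1 (by positivity : 0 ≤ Real.log n / 80)
      have h4 := mul_pos hGp hlog
      nlinarith
    have hd := (hGd S p).sub (hhd p)
    have hev := (hasDerivWithinAt_iff_tendsto_slope' (Set.self_notMem_Ioi)).1
      (hd.hasDerivWithinAt (s := Set.Ioi p)) |>.eventually (lt_mem_nhds (sub_pos.2 hIlt))
    obtain ⟨q, hq, hpq, hq2⟩ := (hev.and (Ioo_mem_nhdsGT hplt)).exists
    rw [slope_def_field, lt_div_iff₀ (sub_pos.2 hpq), zero_mul] at hq
    simp only [Pi.sub_apply] at hq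
    have hGpq := hGmono S p q hpI.1 hpq.le hq2.le
    have hqK : q ∈ K S := ⟨⟨hpI.1.trans hpq.le, hq2.le⟩, by linarith, hp2.trans hGpq⟩
    exact absurd (hpmax hqK) (not_le.2 hpq)
  · -- Forcing an influential coordinate contradicts the maximality of `S`.
    push Not at hinf
    obtain ⟨i, hi⟩ := hinf
    have hup : G (insert i S) p =
        G S p + (1 - p) * mean p (deriv₁ i (fun x => f (x ⊔ ind S))) := by
      simp only [hG, sup_ind_insert]
      exact mean_update_true i (fun x => f (x ⊔ ind S))
    have hiS : i ∉ S := by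
      intro hmem
      rw [Finset.insert_eq_of_mem hmem] at hup
      have : 0 < mean p (deriv₁ i (fun x => f (x ⊔ ind S))) := lt_trans (by positivity) hi
      nlinarith
    have hgain : G S p + 1 / (2 * √n) ≤ G (insert i S) p := by
      rw [hup]
      have e : 1 / (2 * √(n : ℝ)) = 1 / 2 * (1 / √n) := by field_simp
      have : 0 < 1 / √(n : ℝ) := by positivity
      rw [e]
      nlinarith
    have hne : (K (insert i S)).Nonempty := by
      refine ⟨p, hpI, ?_, ?_⟩
      · have : 0 < 1 / (2 * √(n : ℝ)) := by positivity
        linarith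
      · rw [Finset.card_insert_of_notMem hiS]
        push_cast
        rw [add_div]
        linarith
    have := hmax _ hne
    rw [Finset.card_insert_of_notMem hiS] at this
    omega

end Coalition

/-! ### Compression to increasing events -/

section Compression

variable {n : ℕ}

/-- The real-valued indicator of a Boolean function. -/
def realInd (f : (Fin n → Bool) → Bool) (x : Fin n → Bool) : ℝ := ((f x).toNat : ℝ)

/-- The indicator of the points that can be moved into `f = 1` by changing coordinates in `S`. -/
noncomputable def shadow (S : Finset (Fin n)) (f : (Fin n → Bool) → Bool) (x : Fin n → Bool) :
    Bool :=
  open Classical in decide (∃ y, (∀ i ∉ S, y i = x i) ∧ f y = true)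

theorem shadow_eq_true {S : Finset (Fin n)} {f : (Fin n → Bool) → Bool} {x : Fin n → Bool} :
    shadow S f x = true ↔ ∃ y, (∀ i ∉ S, y i = x i) ∧ f y = true := by
  simp [shadow]

/-- Up-compression in direction `i`: in each pair of points differing in coordinate `i` of which
exactly one satisfies `f`, the upper point is made the one that does. -/
def upCompress (i : Fin n) (f : (Fin n → Bool) → Bool) (x : Fin n → Bool) : Bool :=
  if x i then f (Function.update x i true) || f (Function.update x i false)
  else f (Function.update x i true) && f (Function.update x i false)

theorem upCompress_update_true (i : Fin n) (f : (Fin n → Bool) → Bool) (x : Fin n → Bool) :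
    upCompress i f (Function.update x i true) =
      (f (Function.update x i true) || f (Function.update x i false)) := by
  simp [upCompress]

theorem upCompress_update_false (i : Fin n) (f : (Fin n → Bool) → Bool) (x : Fin n → Bool) :
    upCompress i f (Function.update x i false) =
      (f (Function.update x i true) && f (Function.update x i false)) := by
  simp [upCompress]

theorem mean_half_upCompress (i : Fin n) (f : (Fin n → Bool) → Bool) :
    mean (1 / 2) (realInd (upCompress i f)) = mean (1 / 2) (realInd f) := by
  rw [← mean_average i, ← mean_average i (realInd f)]
  congr 1; ext x
  simp only [realInd, upCompress_update_true, upCompress_update_false]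
  cases f (Function.update x i true) <;> cases f (Function.update x i false) <;> norm_num

/-- The shadow of a compression lies in the shadow of `f` if `S` contains the direction `i` of the
compression, and in the compression of that shadow otherwise. -/
theorem shadow_upCompress_le (i : Fin n) (S : Finset (Fin n)) (f : (Fin n → Bool) → Bool)
    (x : Fin n → Bool) (hx : shadow S (upCompress i f) x = true) :
    (i ∈ S → shadow S f x = true) ∧ (i ∉ S → upCompress i (shadow S f) x = true) := by
  obtain ⟨y, hy, hfy⟩ := shadow_eq_true.1 hx
  refine ⟨fun hi => ?_, fun hi => ?_⟩
  · rw [shadow_eq_true]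
    have move : ∀ b, ∀ j ∉ S, Function.update y i b j = x j := by
      intro b j hj
      have : j ≠ i := fun h => hj (h ▸ hi)
      rw [Function.update_of_ne this, hy j hj]
    have : f (Function.update y i true) = true ∨ f (Function.update y i false) = true := by
      unfold upCompress at hfy
      split_ifs at hfy <;> simp_all
    rcases this with h | h
    · exact ⟨_, move _, h⟩
    · exact ⟨_, move _, h⟩
  · have move : ∀ b, f (Function.update y i b) = true →
        shadow S f (Function.update x i b) = true := by
      intro b hb
      refine shadow_eq_true.2 ⟨_, fun j hj => ?_, hb⟩
      by_cases h : j = i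
      · subst h; simp
      · rw [Function.update_of_ne h, Function.update_of_ne h, hy j hj]
    unfold upCompress at hfy ⊢
    rw [← hy i hi]
    split_ifs at hfy ⊢ with hc
    · rw [Bool.or_eq_true] at hfy ⊢
      exact hfy.imp (move _) (move _)
    · rw [Bool.and_eq_true] at hfy ⊢
      exact ⟨move _ hfy.1, move _ hfy.2⟩

theorem realInd_mono {f g : (Fin n → Bool) → Bool} {x : Fin n → Bool}
    (h : f x = true → g x = true) : realInd f x ≤ realInd g x := by
  unfold realInd
  cases hf : f x <;> cases hg : g x <;> simp_all

theorem mean_half_shadow_upCompress_le (i : Fin n) (S : Finset (Fin n))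
    (f : (Fin n → Bool) → Bool) :
    mean (1 / 2) (realInd (shadow S (upCompress i f))) ≤ mean (1 / 2) (realInd (shadow S f)) := by
  by_cases hi : i ∈ S
  · exact mean_mono (by norm_num) (by norm_num) fun x =>
      realInd_mono fun hx => (shadow_upCompress_le i S f x hx).1 hi
  · rw [← mean_half_upCompress i (shadow S f)]
    exact mean_mono (by norm_num) (by norm_num) fun x =>
      realInd_mono fun hx => (shadow_upCompress_le i S f x hx).2 hi

theorem monotone_of_update {f : (Fin n → Bool) → ℝ}
    (h : ∀ i x, f (Function.update x i false) ≤ f (Function.update x i true)) : Monotone f := by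
  induction n with
  | zero => intro x y _; rw [Subsingleton.elim x y]
  | succ n ih =>
    intro x y hxy
    rw [← Fin.cons_self_tail x, ← Fin.cons_self_tail y]
    have h1 : f (Fin.cons (x 0) (Fin.tail x)) ≤ f (Fin.cons (y 0) (Fin.tail x)) := by
      have h0 := hxy 0
      have := h 0 x
      rw [← Fin.cons_self_tail x] at this
      simp only [Fin.update_cons_zero] at this
      cases hx : x 0 <;> cases hy : y 0 <;> rw [hx, hy] at h0
      · exact this
      · exact absurd h0 (show ¬(true ≤ false) by decide)
    refine h1.trans (ih (f := fun z => f (Fin.cons (y 0) z)) ?_ fun i => hxy i.succ)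
    intro i z
    have := h i.succ (Fin.cons (y 0) z)
    simpa only [← Fin.cons_update] using this

/-- Among the Boolean functions with the mean of `f` and no larger shadows, one of maximal
`3/4`-biased mean is monotone, since a compression that changes it would increase that mean. -/
theorem exists_monotone_shadow_le (f : (Fin n → Bool) → Bool) :
    ∃ g : (Fin n → Bool) → Bool, Monotone (realInd g) ∧
      mean (1 / 2) (realInd g) = mean (1 / 2) (realInd f) ∧
      ∀ S, mean (1 / 2) (realInd (shadow S g)) ≤ mean (1 / 2) (realInd (shadow S f)) := by
  classical
  obtain ⟨g, hg, hmax⟩ := Finset.exists_max_image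
    (Finset.univ.filter fun g : (Fin n → Bool) → Bool =>
      mean (1 / 2) (realInd g) = mean (1 / 2) (realInd f) ∧
      ∀ S, mean (1 / 2) (realInd (shadow S g)) ≤ mean (1 / 2) (realInd (shadow S f)))
    (fun g => mean (3 / 4) (realInd g)) ⟨f, by simp⟩
  simp only [Finset.mem_filter, Finset.mem_univ, true_and] at hg hmax
  refine ⟨g, monotone_of_update ?_, hg⟩
  intro i x
  by_contra! hlt
  obtain ⟨hT, hF⟩ : g (Function.update x i true) = false ∧
      g (Function.update x i false) = true := by
    unfold realInd at hlt
    revert hlt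
    cases g (Function.update x i true) <;> cases g (Function.update x i false) <;> norm_num
  have hle := hmax (upCompress i g)
    ⟨(mean_half_upCompress i g).trans hg.1,
      fun S => (mean_half_shadow_upCompress_le i S g).trans (hg.2 S)⟩
  refine absurd hle (not_le.2 ?_)
  rw [← mean_average i, ← mean_average i (realInd (upCompress i g))]
  refine mean_lt (by norm_num) (by norm_num) (y := x) (fun z => ?_) ?_
  · simp only [realInd, upCompress_update_true, upCompress_update_false]
    cases g (Function.update z i true) <;> cases g (Function.update z i false) <;> norm_num
  · simp only [realInd, upCompress_update_true, upCompress_update_false, hT, hF]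
    norm_num

end Compression

/-! ### Coalitional influence as a biased mean -/

section Measure

variable {n : ℕ}

theorem unifMeasure_eq_mean (f : (Fin n → Bool) → Bool) :
    unifMeasure {x | f x = true} = mean (1 / 2) (realInd f) := by
  rw [mean_half_eq_sum, unifMeasure, Set.ncard_eq_toFinset_card']
  congr 1
  · simp only [realInd, Finset.card_filter, Set.toFinset_ofPred]
    push_cast
    refine Finset.sum_congr rfl fun x _ => ?_
    cases f x <;> simp
  · simp [Cube]

theorem jPlus_eq_mean (S : Finset (Fin n)) (f : (Fin n → Bool) → Bool) :
    jPlus S f = mean (1 / 2) (realInd (shadow S f)) := by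
  rw [← unifMeasure_eq_mean, jPlus, influencePlus, sub_add_cancel]
  set U : Set (Cube {i : Fin n // i ∉ S}) :=
    {u | ∃ v : Cube {i : Fin n // i ∈ S}, f (glue S u v) = true} with hU
  -- A point of the cube is a pair `(v, u)`, and its shadow membership depends on `u` only.
  let e := Equiv.piEquivPiSubtypeProd (fun i => i ∈ S) (fun _ : Fin n => Bool)
  have himg : {x | shadow S f x = true} = e ⁻¹' (Set.univ ×ˢ U) := by
    ext x
    simp only [Set.mem_ofPred_eq, shadow_eq_true, Set.mem_preimage, Set.mem_prod, Set.mem_univ,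
      true_and, hU]
    constructor
    · rintro ⟨y, hy, hfy⟩
      refine ⟨fun i => y i, ?_⟩
      have : glue S (e x).2 (fun i => y i) = y := by
        ext i
        by_cases hi : i ∈ S
        · simp [glue, hi]
        · simp [glue, hi, e, Equiv.piEquivPiSubtypeProd, hy i hi]
      rwa [this]
    · rintro ⟨v, hv⟩
      exact ⟨_, fun i hi => by simp [glue, hi, e, Equiv.piEquivPiSubtypeProd], hv⟩
  have hcard : Fintype.card (Cube (Fin n)) =
      Fintype.card (Cube {i : Fin n // i ∈ S}) * Fintype.card (Cube {i : Fin n // i ∉ S}) := by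
    rw [← Fintype.card_prod]; exact Fintype.card_congr e
  rw [himg, unifMeasure, unifMeasure, Set.ncard_preimage_of_injective_subset_range e.injective
    (by simp), Set.ncard_prod, Set.ncard_univ, Nat.card_eq_fintype_card, hcard]
  push_cast
  have : (Fintype.card (Cube {i : Fin n // i ∈ S}) : ℝ) ≠ 0 := by
    exact_mod_cast Fintype.card_ne_zero
  rw [mul_div_mul_left _ _ this]

end Measure

/-! ### Lowering the exponent at small bias -/

section LowBias

variable {n : ℕ}

/-- A Chernoff bound: it is exponentially unlikely that an `s`-biased point has more than
`(s + η) n` ones. -/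
theorem mean_card_gt_le {s η : ℝ} (hs0 : 0 ≤ s) (hs1 : s ≤ 1) (hη0 : 0 < η) (hη1 : η ≤ 1) :
    mean s (fun x : Fin n → Bool =>
      if (s + η) * n < ∑ i, ((x i).toNat : ℝ) then (1 : ℝ) else 0) ≤
        Real.exp (-(η ^ 2 / 4) * n) := by
  -- Markov's inequality for `exp (l * |x|)` with `l = η / 2`.
  obtain ⟨l, hl⟩ : ∃ l, l = η / 2 := ⟨_, rfl⟩
  have hl0 : 0 < l := by rw [hl]; positivity
  have hexp : Real.exp l ≤ 1 + l + l ^ 2 := by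
    have := Real.abs_exp_sub_one_sub_id_le (x := l) (by rw [abs_of_pos hl0]; linarith)
    linarith [le_abs_self (Real.exp l - 1 - l)]
  have hbase : 1 - s + s * Real.exp l ≤ Real.exp (s * l + l ^ 2) := by
    have h1 := Real.add_one_le_exp (s * l + l ^ 2)
    have h2 := mul_le_mul_of_nonneg_left hexp hs0
    nlinarith [mul_le_mul_of_nonneg_right hs1 (sq_nonneg l)]
  calc _ ≤ mean s (fun x : Fin n → Bool => Real.exp (-(l * ((s + η) * n))) *
        Real.exp (l * ∑ i, ((x i).toNat : ℝ))) := by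
        refine mean_mono hs0 hs1 fun x => ?_
        rw [← Real.exp_add]
        split_ifs with h
        · rw [Real.one_le_exp_iff]
          nlinarith [mul_lt_mul_of_pos_left h hl0]
        · positivity
    _ = Real.exp (-(l * ((s + η) * n))) * (1 - s + s * Real.exp l) ^ n := by
        rw [mean_const_mul, mean_exp_card]
    _ ≤ Real.exp (-(l * ((s + η) * n))) * Real.exp (s * l + l ^ 2) ^ n := by
        gcongr
    _ = _ := by
        rw [← Real.exp_nat_mul, ← Real.exp_add]
        congr 1
        rw [hl]; ring

/-- Write a uniform point as `x ⊔ y` with `x` of bias `s < 1/2` and `y` of small bias `t`. Some `x`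
with at most `(s + η) n` ones makes the conditional probability of the event at least half of what
it is on average. -/
theorem exists_coalition_low_bias {s t η : ℝ} (hs0 : 0 ≤ s) (hs1 : s ≤ 1) (ht0 : 0 ≤ t)
    (ht1 : t ≤ 1) (hst : 1 - (1 - s) * (1 - t) = 1 / 2) (hη0 : 0 < η) (hη1 : η ≤ 1)
    {f : (Fin n → Bool) → ℝ} (hf01 : ∀ x, f x = 0 ∨ f x = 1)
    (hbig : 2 * Real.exp (-(η ^ 2 / 4) * n) < mean (1 / 2) f) :
    ∃ S : Finset (Fin n), (S.card : ℝ) ≤ (s + η) * n ∧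
      mean (1 / 2) f / 2 ≤ mean t (fun x => f (x ⊔ ind S)) := by
  by_contra! hcon
  have hpt : ∀ x : Fin n → Bool, mean t (fun y => f (x ⊔ y)) ≤ mean (1 / 2) f / 2 +
      if (s + η) * n < ∑ i, ((x i).toNat : ℝ) then (1 : ℝ) else 0 := by
    intro x
    split_ifs with h
    · have h1 : mean t (fun y => f (x ⊔ y)) ≤ 1 := by
        simpa only [mean_const] using mean_mono ht0 ht1 (g := fun _ => (1 : ℝ)) fun y => by
          rcases hf01 (x ⊔ y) with h | h <;> simp [h]
      have h2 : 0 ≤ mean (1 / 2) f := mean_nonneg (by norm_num) (by norm_num) fun y => by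
          rcases hf01 y with h | h <;> simp [h]
      linarith
    · have hx : ind (Finset.univ.filter fun i => x i = true) = x := by
        ext i; simp [ind]
      have hc : (((Finset.univ.filter fun i => x i = true).card : ℕ) : ℝ) =
          ∑ i, ((x i).toNat : ℝ) := by
        rw [Finset.card_filter]
        push_cast
        refine Finset.sum_congr rfl fun i _ => ?_
        cases x i <;> simp
      have := hcon (Finset.univ.filter fun i => x i = true) (by rw [hc]; exact not_lt.1 h)
      rw [hx] at this
      simp only [sup_comm x]
      linarith
  have h := mean_mono hs0 hs1 hpt
  rw [mean_mean_sup, hst, mean_add, mean_const] at h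
  have := mean_card_gt_le (n := n) hs0 hs1 hη0 hη1
  linarith

end LowBias

open Filter Topology in
/-- The conditions on `n` used below hold from some point on. -/
theorem eventually_large (C η : ℝ) (hη : 0 < η) :
    ∀ᶠ n : ℕ in atTop, 1 < n ∧ 2 * Real.exp (-(η ^ 2 / 4) * n) < (n : ℝ) ^ (-C) ∧
      2 * √(n : ℝ) ≤ η * n ∧ 2 ≤ Real.exp (Real.log n / 640) := by
  have hc : Tendsto (fun n : ℕ => (n : ℝ)) atTop atTop := tendsto_natCast_atTop_atTop
  refine (eventually_gt_atTop 1).and (.and ?_ (.and ?_ ?_))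
  · have h := (tendsto_rpow_mul_exp_neg_mul_atTop_nhds_zero C (η ^ 2 / 4) (by positivity)).comp hc
    filter_upwards [h.eventually (gt_mem_nhds (by norm_num : (0 : ℝ) < 1 / 2)),
      eventually_gt_atTop 0] with n hn hn0
    have hn0' : (0 : ℝ) < n := by exact_mod_cast hn0
    have hpow := Real.rpow_pos_of_pos hn0' C
    simp only [Function.comp] at hn
    rw [Real.rpow_neg hn0'.le, lt_inv_comm₀ (by positivity) hpow]
    rw [lt_inv_comm₀ hpow (by positivity), ← one_div, lt_div_iff₀ hpow]
    linarith
  · have h := (Real.tendsto_sqrt_atTop.comp hc).eventually_ge_atTop (2 / η)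
    filter_upwards [h] with n hn
    simp only [Function.comp] at hn
    rw [div_le_iff₀ hη] at hn
    have := mul_le_mul_of_nonneg_right hn (Real.sqrt_nonneg (n : ℝ))
    have e := Real.mul_self_sqrt (Nat.cast_nonneg (α := ℝ) n)
    nlinarith
  · exact (Real.tendsto_exp_atTop.comp
      ((Real.tendsto_log_atTop.comp hc).atTop_div_const (by norm_num))).eventually_ge_atTop 2

end BooleanInfluence

open BooleanInfluence

theorem theorem1p3 (C : ℝ) (hC : 0 < C) :
    ∃ δ : ℝ, 0 < δ ∧ ∃ n₀ : ℕ, ∀ n : ℕ, n₀ ≤ n →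
      ∀ f : BooleanInfluence.Cube (Fin n) → Bool,
        (n : ℝ) ^ (-C) < BooleanInfluence.expect f →
          ∃ S : Finset (Fin n), (S.card : ℝ) ≤ (1 / 2 - δ) * (n : ℝ) ∧
            (0.9 : ℝ) < BooleanInfluence.jPlus S f := by
  -- `k` makes the exponent `C / k` small enough for `exists_small_coalition`.
  obtain ⟨k, hk⟩ := exists_nat_ge (640 * C + 1)
  have hk1 : (1 : ℝ) ≤ k := by linarith
  have hk0 : k ≠ 0 := by rintro rfl; norm_num at hk1
  set t : ℝ := (1 / 4) ^ k with ht
  have ht0 : 0 < t := by positivity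
  have ht1 : t ≤ 1 / 4 := pow_le_of_le_one (by norm_num) (by norm_num) hk0
  -- `s` is the bias for which the join of an `s`-biased and a `t`-biased point is uniform.
  set s : ℝ := 1 - 1 / (2 * (1 - t)) with hs
  have h1t : 0 < 1 - t := by linarith
  have hst : 1 - (1 - s) * (1 - t) = 1 / 2 := by rw [hs]; field_simp; ring
  have hs_le : s ≤ 1 / 2 - t / 2 := by nlinarith
  have hs0 : 0 ≤ s := by
    by_contra! h
    nlinarith
  obtain ⟨n₀, hn₀⟩ := Filter.eventually_atTop.1 (eventually_large C (t / 8) (by positivity))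
  refine ⟨t / 4, by positivity, n₀, fun n hn f hf => ?_⟩
  obtain ⟨hn1, hchern, hsqrt, hexp⟩ := hn₀ n hn
  have hn0 : (0 : ℝ) < n := by exact_mod_cast zero_lt_one.trans hn1
  obtain ⟨g, hgmono, hgmean, hgshadow⟩ := exists_monotone_shadow_le f
  have hg01 : ∀ x, realInd g x = 0 ∨ realInd g x = 1 := by
    intro x; unfold realInd; cases g x <;> simp
  have hmean : (n : ℝ) ^ (-C) < mean (1 / 2) (realInd g) := by
    rw [hgmean, ← unifMeasure_eq_mean]; exact hf
  obtain ⟨S₀, hS₀, hlow⟩ := exists_coalition_low_bias hs0 (by linarith) ht0.le (by linarith) hst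
    (by positivity : 0 < t / 8) (by linarith) hg01 (hchern.trans hmean)
  have hbias : 1 ≤ mean (1 / 4) (fun x => realInd g (x ⊔ ind S₀)) *
      Real.exp (Real.log n / 320) := by
    set b := mean (1 / 4) (fun x => realInd g (x ⊔ ind S₀)) with hb
    have hb0 : 0 ≤ b := mean_nonneg (by norm_num) (by norm_num) fun x => by
      rcases hg01 (x ⊔ ind S₀) with h | h <;> simp [h]
    have hpow : mean t (fun x => realInd g (x ⊔ ind S₀)) ≤ b ^ k :=
      mean_pow_le (monotone_sup_ind hgmono S₀) (fun x => hg01 _) (by norm_num) (by norm_num) k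
    have hlog : 0 ≤ Real.log n := Real.log_nonneg (by exact_mod_cast hn1.le)
    -- After raising to the power `k`, half of the exponential absorbs `n ^ (-C)`, the other half
    -- the factor `1 / 2`.
    have hEk : (1 : ℝ) ≤ (b * Real.exp (Real.log n / 320)) ^ k := by
      have e1 : Real.exp (Real.log n / 320) =
          Real.exp (Real.log n / 640) * Real.exp (Real.log n / 640) := by
        rw [← Real.exp_add]; congr 1; ring
      have h1 : (2 : ℝ) ≤ Real.exp (Real.log n / 640) ^ k :=
        hexp.trans (le_self_pow₀ (by linarith) hk0)
      have h2 : (n : ℝ) ^ C ≤ Real.exp (Real.log n / 640) ^ k := by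
        rw [← Real.exp_nat_mul, Real.rpow_def_of_pos hn0]
        apply Real.exp_le_exp.2
        nlinarith
      have h3 : (n : ℝ) ^ (-C) / 2 ≤ b ^ k := by linarith
      rw [mul_pow, e1, mul_pow]
      have h4 : (n : ℝ) ^ (-C) * (n : ℝ) ^ C = 1 := by
        rw [← Real.rpow_add hn0]; simp
      have h5 : 0 < (n : ℝ) ^ C := Real.rpow_pos_of_pos hn0 C
      calc (1 : ℝ) = (n : ℝ) ^ (-C) / 2 * ((n : ℝ) ^ C * 2) := by linarith
        _ ≤ _ := by gcongr
    by_contra! hlt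
    exact absurd hEk (not_le.2 (pow_lt_one₀ (by positivity) hlt hk0))
  obtain ⟨S₁, hS₁, hfinal⟩ := exists_small_coalition (monotone_sup_ind hgmono S₀)
    (fun x => hg01 _) hn1 hbias
  refine ⟨S₀ ∪ S₁, ?_, ?_⟩
  · have hc : ((S₀ ∪ S₁).card : ℝ) ≤ S₀.card + S₁.card := by
      exact_mod_cast Finset.card_union_le S₀ S₁
    nlinarith
  · rw [jPlus_eq_mean]
    refine hfinal.trans_le (le_trans ?_ (hgshadow _))
    refine mean_mono (by norm_num) (by norm_num) fun x => ?_
    have hx : x ⊔ ind S₁ ⊔ ind S₀ = x ⊔ ind (S₀ ∪ S₁) := by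
      ext i; simp [ind, Bool.or_comm, Bool.or_left_comm]
    rw [hx]
    unfold realInd
    cases hgx : g (x ⊔ ind (S₀ ∪ S₁))
    · simp
    · have : shadow (S₀ ∪ S₁) g x = true := by
        refine shadow_eq_true.2 ⟨_, fun i hi => ?_, hgx⟩
        simp only [Pi.sup_apply, ind, hi, decide_false]
        simp
      simp [this]
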